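/- Let $n\ge 1$, let $\mathbb B^n=\{x\in\mathbb R^n:|x|<1\}$, and let $k$ denote the quasihyperbolic metric of $\mathbb B^n$, that is, $$k(x,y)=\inf_\gamma\int_\gamma\frac{|dz|}{d(z,\partial\mathbb B^n)},\qquad x,y\in\mathbb B^n,$$ where the infimum is taken over all rectifiable curves $\gamma$ in $\mathbb B^n$ joining $x$ and $y$ and $d(z,\partial\mathbb B^n)$ is the Euclidean distance from $z$ to the boundary of $\mathbb B^n$. Let $a\in\mathbb B^n$, and let $h:\mathbb B^n\to\mathbb B^n$ be a Möbius transformation of $\mathbb B^n$ onto itself (the restriction to $\mathbb B^n$ of a finite composition of inversions in spheres and reflections in hyperplanes of $\mathbb R^n\cup\{\infty\}$) with $h(a)=0$. Then for all $x,y\in\mathbb B^n$ $$\frac{1}{1+|a|}\,k(x,y)\le k(h(x),h(y))\le (1+|a|)\,k(x,y).$$ Both constants are sharp for every such $h$: if $c\in\mathbb R$ satisfies $k(h(x),h(y))\le c\,k(x,y)$ for all $x,y\in\mathbb B^n$, then $c\ge 1+|a|$; and if $c\in\mathbb R$ satisfies $c\,k(x,y)\le k(h(x),h(y))$ for all $x,y\in\mathbb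 B^n$, then $c\le 1/(1+|a|)$. -/

import Mathlib

open Set Metric

noncomputable section

/-! ### Quasihyperbolic metric -/

section Quasihyperbolic

variable {E : Type*} [NormedAddCommGroup E]

/-- `γ : [s, t] → E` is a rectifiable curve in `D` from `x` to `y`: it is continuous, of finite
length, and stays in `D`. -/
structure IsRectifiableCurveIn (D : Set E) (x y : E) (γ : ℝ → E) (s t : ℝ) : Prop where
  le : s ≤ t
  continuousOn : ContinuousOn γ (Icc s t)
  boundedVariationOn : BoundedVariationOn γ (Icc s t)
  mapsTo : MapsTo γ (Icc s t) D
  source : γ s = x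
  target : γ t = y

/-- The Euclidean length of the curve `γ : [s, t] → E`. -/
def curveLength (γ : ℝ → E) (s t : ℝ) : ℝ :=
  (eVariationOn γ (Icc s t)).toReal

/-- The line integral `∫_γ ρ |dz|` with respect to arc length along a rectifiable curve
`γ : [s, t] → E`: the integral of `ρ` along the arc length parametrization of `γ`. -/
def arcLengthIntegral (ρ : E → ℝ) (γ : ℝ → E) (s t : ℝ) : ℝ :=
  ∫ u in (0 : ℝ)..curveLength γ s t, ρ (naturalParameterization γ (Icc s t) s u)

/-- The quasihyperbolic metric of a proper subdomain `D`: the infimum of `∫_γ |dz| / d(z, ∂D)` over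
all rectifiable curves `γ` in `D` joining `x` and `y`. -/
def quasihyperbolicDist (D : Set E) (x y : E) : ℝ :=
  sInf {l : ℝ | ∃ (γ : ℝ → E) (s t : ℝ), IsRectifiableCurveIn D x y γ s t ∧
    l = arcLengthIntegral (fun z => 1 / infDist z (frontier D)) γ s t}

end Quasihyperbolic

/-! ### Möbius transformations -/

section Mobius

variable {E : Type*} [NormedAddCommGroup E] [InnerProductSpace ℝ E]

open Classical in
/-- Inversion of the extended space `E ∪ {∞}` in the sphere with centre `c` and radius `r`; it
interchanges `c` and `∞`. -/
def sphereInversionFun (c : E) (r : ℝ) : OnePoint E → OnePoint E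
  | none => (c : OnePoint E)
  | some x => if x = c then OnePoint.infty else (EuclideanGeometry.inversion c r x : E)

theorem sphereInversionFun_involutive (c : E) {r : ℝ} (hr : 0 < r) :
    Function.Involutive (sphereInversionFun c r) := by
  intro z
  induction z using OnePoint.rec with
  | infty =>
    change sphereInversionFun c r (some c) = _
    simp [sphereInversionFun]
  | coe x =>
    change sphereInversionFun c r (sphereInversionFun c r (some x)) = _
    by_cases hx : x = c
    · subst hx
      simp only [sphereInversionFun, if_true]
    · have h : sphereInversionFun c r (some x) = some (EuclideanGeometry.inversion c r x) := by
        simp only [sphereInversionFun, if_neg hx]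
        rfl
      rw [h]
      simp only [sphereInversionFun]
      rw [if_neg (by rwa [EuclideanGeometry.inversion_eq_center hr.ne']),
        EuclideanGeometry.inversion_inversion c hr.ne']

/-- Inversion in the sphere with centre `c` and radius `r > 0`, as a bijection of `E ∪ {∞}`. -/
def sphereInversion (c : E) (r : ℝ) (hr : 0 < r) : Equiv.Perm (OnePoint E) :=
  (sphereInversionFun_involutive c hr).toPerm

/-- Reflection of `E ∪ {∞}` in the hyperplane `p + v^⊥`; it maps `x` to
`p + R (x - p)`, where `R` is the linear reflection in `v^⊥`, and fixes `∞`. -/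
def hyperplaneReflection (p v : E) : Equiv.Perm (OnePoint E) :=
  Equiv.optionCongr
    ((Equiv.subRight p).trans
      ((Submodule.span ℝ {v})ᗮ.reflection.toEquiv.trans (Equiv.addRight p)))

variable (E) in
/-- The general Möbius group of `E ∪ {∞}`, generated by the inversions in spheres and the
reflections in hyperplanes. -/
def mobiusGroup : Subgroup (Equiv.Perm (OnePoint E)) :=
  Subgroup.closure
    ({g | ∃ (c : E) (r : ℝ) (hr : 0 < r), g = sphereInversion c r hr} ∪
      {g | ∃ p v : E, v ≠ 0 ∧ g = hyperplaneReflection p v})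

/-- On `D`, the map `h` is the restriction of a Möbius transformation, and it maps `D` onto `D`. -/
def IsMobiusSelfMap (D : Set E) (h : E → E) : Prop :=
  h '' D = D ∧ ∃ g ∈ mobiusGroup E, ∀ x ∈ D, g (x : OnePoint E) = (h x : OnePoint E)

end Mobius

end

/-! ### Arc length parametrization and the quasihyperbolic metric of a general domain -/

section Curves

open Filter Topology MeasureTheory
open scoped Interval

/-! A Möbius self-map `h` of the ball is a hyperbolic isometry: `|h x - h y|² / ((1 - |h x|²)(1 - |h
y|²))` equals the same expression in `x, y` (`IsMobiusSelfMap.norm_sub_sq`). Letting `y → x`, it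
stretches lengths at `z` by `(1 - |h z|²) / (1 - |z|²)`. The quasihyperbolic density of the ball is
`1 / (1 - |z|)`, so `h` stretches quasihyperbolic length at `z` by `(1 + |h z|) / (1 + |z|)`. This
is at most `1 + |a|`, because `|h z| ≤ |z| + |a|` (`one_add_norm_le`).

At `z = 0` the factor is exactly `1 + |h 0| = 1 + |a|`, hence sharpness. The inverse of `h` maps `h
0` to `0` and `|h 0| = |a|`, so both claims about the lower constant follow from those about the
upper one.

Derivatives of `h` are avoided. The upper bound applies the local-to-global principle
`sub_le_mul_quasihyperbolicDist` to `z ↦ k(h x, h z)`. The sharpness compares first-order estimates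
of `k` near `0` and near `h 0`. The distance identity comes from the two-point distortion formula of
the Möbius group (`exists_distortion_of_mem_mobiusGroup`). -/

theorem continuousOn_variationOnFromTo {M : Type*} [PseudoMetricSpace M] {f : ℝ → M} {s : Set ℝ}
    (hf : LocallyBoundedVariationOn f s) (hc : ContinuousOn f s) {a : ℝ} (ha : a ∈ s) :
    ContinuousOn (variationOnFromTo f s a) s := by
  intro b hb
  have h1 : ContinuousWithinAt (variationOnFromTo f s a) (s ∩ Iio b) b := by
    have := variationOnFromTo.tendsto_left ha hb hf ((hc b hb).mono_left
      (nhdsWithin_mono b inter_subset_left))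
    simpa [ContinuousWithinAt] using this
  have h2 : ContinuousWithinAt (variationOnFromTo f s a) (s ∩ Ioi b) b := by
    have := variationOnFromTo.tendsto_right ha hb hf ((hc b hb).mono_left
      (nhdsWithin_mono b inter_subset_left))
    simpa [ContinuousWithinAt] using this
  have h3 := (continuousWithinAt_insert_self.2 (continuousWithinAt_union.2 ⟨h1, h2⟩))
  refine h3.mono fun x hx => ?_
  rcases lt_trichotomy x b with h | h | h
  · exact Or.inr (Or.inl ⟨hx, h⟩)
  · exact Or.inl h
  · exact Or.inr (Or.inr ⟨hx, h⟩)

variable {E : Type*} [NormedAddCommGroup E]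

theorem HasUnitSpeedOn.norm_sub_le {φ : ℝ → E} {s : Set ℝ} (h : HasUnitSpeedOn φ s) {u v : ℝ}
    (hu : u ∈ s) (hv : v ∈ s) : ‖φ u - φ v‖ ≤ |u - v| := by
  wlog huv : u ≤ v generalizing u v
  · rw [norm_sub_rev, abs_sub_comm]
    exact this hv hu (le_of_not_ge huv)
  have h1 := h hu hv
  have h2 := eVariationOn.edist_le φ (s := s ∩ Icc u v) (x := u) (y := v) ⟨hu, le_rfl, huv⟩
    ⟨hv, huv, le_rfl⟩
  rw [h1, edist_dist, NNReal.coe_one, one_mul, dist_eq_norm] at h2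
  rw [abs_sub_comm, abs_of_nonneg (sub_nonneg.2 huv)]
  exact (ENNReal.ofReal_le_ofReal_iff (sub_nonneg.2 huv)).1 h2

theorem HasUnitSpeedOn.continuousOn {φ : ℝ → E} {s : Set ℝ} (h : HasUnitSpeedOn φ s) :
    ContinuousOn φ s :=
  (LipschitzOnWith.of_dist_le_mul (K := 1) fun u hu v hv => by
    simpa [dist_eq_norm] using h.norm_sub_le hu hv).continuousOn

/-- `φ : [0, L] → E` is a curve in `D` from `x` to `y` that is parametrized by arc length. -/
structure IsUnitSpeedCurveIn (D : Set E) (x y : E) (φ : ℝ → E) (L : ℝ) : Prop where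
  nonneg : 0 ≤ L
  unitSpeed : HasUnitSpeedOn φ (Icc 0 L)
  mapsTo : MapsTo φ (Icc 0 L) D
  source : φ 0 = x
  target : φ L = y

theorem IsRectifiableCurveIn.isUnitSpeedCurveIn {D : Set E} {x y : E} {γ : ℝ → E} {s t : ℝ}
    (h : IsRectifiableCurveIn D x y γ s t) :
    IsUnitSpeedCurveIn D x y (naturalParameterization γ (Icc s t) s) (curveLength γ s t) := by
  have hbv := h.boundedVariationOn.locallyBoundedVariationOn
  have hs : s ∈ Icc s t := ⟨le_rfl, h.le⟩
  have ht : t ∈ Icc s t := ⟨h.le, le_rfl⟩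
  have e0 : variationOnFromTo γ (Icc s t) s s = 0 := variationOnFromTo.self _ _ _
  have e1 : variationOnFromTo γ (Icc s t) s t = curveLength γ s t := by
    rw [variationOnFromTo.eq_of_le _ _ h.le, inter_self]; rfl
  have key : ∀ b ∈ Icc s t, naturalParameterization γ (Icc s t) s
      (variationOnFromTo γ (Icc s t) s b) = γ b := fun b hb =>
    edist_eq_zero.1 (edist_naturalParameterization_eq_zero hbv hs hb)
  -- The natural parametrization has unit speed on the range of the arc length function; continuity
  -- of `γ` ensures that this range has no gaps.
  have him : variationOnFromTo γ (Icc s t) s '' Icc s t = Icc 0 (curveLength γ s t) := by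
    rw [← e0, ← e1]
    apply Subset.antisymm
    · rintro _ ⟨b, hb, rfl⟩
      exact ⟨variationOnFromTo.monotoneOn hbv hs hs hb hb.1,
        variationOnFromTo.monotoneOn hbv hs hb ht hb.2⟩
    · exact intermediate_value_Icc h.le (continuousOn_variationOnFromTo hbv h.continuousOn hs)
  refine ⟨ENNReal.toReal_nonneg, ?_, ?_, ?_, ?_⟩
  · rw [← him]
    exact has_unit_speed_naturalParameterization γ hbv hs
  · rw [← him]
    rintro _ ⟨b, hb, rfl⟩
    rw [key b hb]
    exact h.mapsTo hb
  · rw [← h.source, ← key s hs, e0]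
  · rw [← h.target, ← key t ht, e1]

namespace IsUnitSpeedCurveIn

variable {D : Set E} {x y z : E} {φ ψ : ℝ → E} {L L' : ℝ}

theorem isRectifiableCurveIn (h : IsUnitSpeedCurveIn D x y φ L) :
    IsRectifiableCurveIn D x y φ 0 L where
  le := h.nonneg
  continuousOn := h.unitSpeed.continuousOn
  boundedVariationOn := by
    have := h.unitSpeed.hasLocallyBoundedVariationOn 0 L ⟨le_rfl, h.nonneg⟩ ⟨h.nonneg, le_rfl⟩
    rwa [inter_self] at this
  mapsTo := h.mapsTo
  source := h.source
  target := h.target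

theorem variationOnFromTo_eq (h : IsUnitSpeedCurveIn D x y φ L) {u : ℝ} (hu : u ∈ Icc 0 L) :
    variationOnFromTo φ (Icc 0 L) 0 u = u := by
  have := (hasConstantSpeedOnWith_iff_variationOnFromTo_eq.1 h.unitSpeed).2
    (⟨le_rfl, h.nonneg⟩ : (0 : ℝ) ∈ Icc 0 L) hu
  simpa using this

theorem curveLength_eq (h : IsUnitSpeedCurveIn D x y φ L) : curveLength φ 0 L = L := by
  have := h.variationOnFromTo_eq ⟨h.nonneg, le_rfl⟩
  rwa [variationOnFromTo.eq_of_le _ _ h.nonneg, inter_self] at this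

theorem naturalParameterization_eq (h : IsUnitSpeedCurveIn D x y φ L) {u : ℝ}
    (hu : u ∈ Icc 0 L) : naturalParameterization φ (Icc 0 L) 0 u = φ u := by
  have := edist_naturalParameterization_eq_zero h.unitSpeed.hasLocallyBoundedVariationOn
    (⟨le_rfl, h.nonneg⟩ : (0 : ℝ) ∈ Icc 0 L) hu
  rwa [h.variationOnFromTo_eq hu, edist_eq_zero] at this

theorem arcLengthIntegral_eq (h : IsUnitSpeedCurveIn D x y φ L) (ρ : E → ℝ) :
    arcLengthIntegral ρ φ 0 L = ∫ u in (0 : ℝ)..L, ρ (φ u) := by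
  rw [arcLengthIntegral, h.curveLength_eq]
  refine intervalIntegral.integral_congr fun u hu => ?_
  rw [uIcc_of_le h.nonneg] at hu
  simp only [h.naturalParameterization_eq hu]

theorem continuousOn_comp (h : IsUnitSpeedCurveIn D x y φ L) {ρ : E → ℝ}
    (hρ : ContinuousOn ρ D) : ContinuousOn (fun u => ρ (φ u)) (Icc 0 L) :=
  hρ.comp h.unitSpeed.continuousOn h.mapsTo

/-- The concatenation of two curves that are parametrized by arc length. -/
theorem trans (h : IsUnitSpeedCurveIn D x y φ L) (h' : IsUnitSpeedCurveIn D y z ψ L') :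
    IsUnitSpeedCurveIn D x z (fun u => if u ≤ L then φ u else ψ (u - L)) (L + L') := by
  have hL := h.nonneg
  have hL' := h'.nonneg
  set χ : ℝ → E := fun u => if u ≤ L then φ u else ψ (u - L)
  have e1 : EqOn χ φ (Icc 0 L) := fun u hu => if_pos hu.2
  have e2 : EqOn χ (fun u => ψ (u - L)) (Icc L (L + L')) := by
    intro u hu
    rcases hu.1.eq_or_lt with rfl | hlt
    · simp [χ, h.target, h'.source]
    · exact if_neg (not_le.2 hlt)
  refine ⟨by linarith, ?_, ?_, ?_, ?_⟩
  · refine HasUnitSpeedOn.Icc_Icc (y := L) ?_ ?_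
    · intro u hu v hv
      rw [eVariationOn.congr (e1.mono inter_subset_left)]
      exact h.unitSpeed hu hv
    · intro u hu v hv
      rw [eVariationOn.congr (e2.mono inter_subset_left)]
      have hmono : MonotoneOn (fun w : ℝ => w - L) (Icc L (L + L')) :=
        fun a _ b _ hab => sub_le_sub_right hab L
      have him : (fun w : ℝ => w - L) '' Icc L (L + L') = Icc 0 L' := by simp
      have := eVariationOn.comp_inter_Icc_eq_of_monotoneOn ψ _ hmono hu hv
      rw [him] at this
      refine this.trans ?_
      rw [h'.unitSpeed ⟨by linarith [hu.1], by linarith [hu.2]⟩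
        ⟨by linarith [hv.1], by linarith [hv.2]⟩]
      congr 2
      ring
  · intro u hu
    rcases le_total u L with hle | hle
    · rw [e1 ⟨hu.1, hle⟩]
      exact h.mapsTo ⟨hu.1, hle⟩
    · rw [e2 ⟨hle, hu.2⟩]
      exact h'.mapsTo ⟨by linarith, by linarith [hu.2]⟩
  · rw [e1 ⟨le_rfl, hL⟩, h.source]
  · rw [e2 ⟨by linarith, le_rfl⟩]
    simp [h'.target]

theorem integral_trans (h : IsUnitSpeedCurveIn D x y φ L) (h' : IsUnitSpeedCurveIn D y z ψ L')
    {ρ : E → ℝ} (hρ : ContinuousOn ρ D) :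
    ∫ u in (0 : ℝ)..(L + L'), ρ (if u ≤ L then φ u else ψ (u - L)) =
      (∫ u in (0 : ℝ)..L, ρ (φ u)) + ∫ u in (0 : ℝ)..L', ρ (ψ u) := by
  have hL := h.nonneg
  have hL' := h'.nonneg
  have hc := (h.trans h').continuousOn_comp hρ
  rw [← intervalIntegral.integral_add_adjacent_intervals (b := L)]
  · congr 1
    · refine intervalIntegral.integral_congr fun u hu => ?_
      rw [uIcc_of_le hL] at hu
      simp only [if_pos hu.2]
    · have : ∫ u in (0 : ℝ)..L', ρ (ψ u) = ∫ u in L..(L + L'), ρ (ψ (u - L)) := by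
        rw [intervalIntegral.integral_comp_sub_right (fun u => ρ (ψ u)) L]
        simp
      rw [this]
      refine intervalIntegral.integral_congr fun u hu => ?_
      rw [uIcc_of_le (by linarith)] at hu
      rcases hu.1.eq_or_lt with rfl | hlt
      · simp [h.target, h'.source]
      · simp only [if_neg (not_le.2 hlt)]
  · refine (hc.mono ?_).intervalIntegrable
    rw [uIcc_of_le hL]
    exact Icc_subset_Icc_right (by linarith)
  · refine (hc.mono ?_).intervalIntegrable
    rw [uIcc_of_le (by linarith)]
    exact Icc_subset_Icc_left hL

end IsUnitSpeedCurveIn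

/-- The arc length integral depends only on the arc length parametrization, so every curve may be
replaced by a unit speed one and the line integral by an ordinary integral. -/
theorem quasihyperbolicDist_eq_sInf (D : Set E) (x y : E) :
    quasihyperbolicDist D x y = sInf {l : ℝ | ∃ (φ : ℝ → E) (L : ℝ),
      IsUnitSpeedCurveIn D x y φ L ∧ l = ∫ u in (0 : ℝ)..L, 1 / infDist (φ u) (frontier D)} := by
  unfold quasihyperbolicDist
  congr 1
  ext l
  constructor
  · rintro ⟨γ, s, t, h, rfl⟩
    exact ⟨_, _, h.isUnitSpeedCurveIn, rfl⟩
  · rintro ⟨φ, L, h, rfl⟩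
    exact ⟨φ, 0, L, h.isRectifiableCurveIn,
      (h.arcLengthIntegral_eq fun z => 1 / infDist z (frontier D)).symm⟩

variable {D : Set E} {x y z : E}

theorem IsUnitSpeedCurveIn.integral_nonneg {φ : ℝ → E} {L : ℝ} (h : IsUnitSpeedCurveIn D x y φ L) :
    0 ≤ ∫ u in (0 : ℝ)..L, 1 / infDist (φ u) (frontier D) :=
  intervalIntegral.integral_nonneg h.nonneg fun _ _ => one_div_nonneg.2 infDist_nonneg

theorem quasihyperbolicDist_nonneg (D : Set E) (x y : E) : 0 ≤ quasihyperbolicDist D x y := by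
  rw [quasihyperbolicDist_eq_sInf]
  apply Real.sInf_nonneg
  rintro _ ⟨φ, L, h, rfl⟩
  exact h.integral_nonneg

theorem IsUnitSpeedCurveIn.quasihyperbolicDist_le {φ : ℝ → E} {L : ℝ}
    (h : IsUnitSpeedCurveIn D x y φ L) :
    quasihyperbolicDist D x y ≤ ∫ u in (0 : ℝ)..L, 1 / infDist (φ u) (frontier D) := by
  rw [quasihyperbolicDist_eq_sInf]
  refine csInf_le ⟨0, ?_⟩ ⟨φ, L, h, rfl⟩
  rintro _ ⟨φ, L, h, rfl⟩
  exact h.integral_nonneg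

/-- A joining curve must exist, since `sInf ∅ = 0` would defeat lower bounds. -/
theorem le_quasihyperbolicDist (hne : ∃ φ L, IsUnitSpeedCurveIn D x y φ L) {c : ℝ}
    (hc : ∀ φ L, IsUnitSpeedCurveIn D x y φ L →
      c ≤ ∫ u in (0 : ℝ)..L, 1 / infDist (φ u) (frontier D)) :
    c ≤ quasihyperbolicDist D x y := by
  rw [quasihyperbolicDist_eq_sInf]
  obtain ⟨φ, L, h⟩ := hne
  refine le_csInf ⟨_, φ, L, h, rfl⟩ ?_
  rintro _ ⟨φ, L, h, rfl⟩
  exact hc φ L h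

theorem continuousOn_one_div_infDist {s : Set E} (hD : ∀ z ∈ D, 0 < infDist z s) :
    ContinuousOn (fun z => 1 / infDist z s) D :=
  continuousOn_const.div (continuous_infDist_pt s).continuousOn fun z hz => (hD z hz).ne'

theorem quasihyperbolicDist_triangle (hD : ∀ z ∈ D, 0 < infDist z (frontier D))
    (hxy : ∃ φ L, IsUnitSpeedCurveIn D x y φ L) (hyz : ∃ φ L, IsUnitSpeedCurveIn D y z φ L) :
    quasihyperbolicDist D x z ≤ quasihyperbolicDist D x y + quasihyperbolicDist D y z := by
  rw [← sub_le_iff_le_add']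
  refine le_quasihyperbolicDist hyz fun ψ L' h' => ?_
  rw [sub_le_comm]
  refine le_quasihyperbolicDist hxy fun φ L h => ?_
  rw [sub_le_iff_le_add, ← h.integral_trans h' (continuousOn_one_div_infDist hD)]
  exact (h.trans h').quasihyperbolicDist_le

/-- A function that grows at `z` at most at the rate `c / d(z, ∂D)` is `c`-Lipschitz with respect
to the quasihyperbolic metric. -/
theorem sub_le_mul_quasihyperbolicDist (hD : ∀ z ∈ D, 0 < infDist z (frontier D))
    (hxy : ∃ φ L, IsUnitSpeedCurveIn D x y φ L) {c : ℝ} (hc : 0 < c) {F : E → ℝ}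
    (hF : ∀ z ∈ D, ∀ r, c / infDist z (frontier D) < r →
      ∀ᶠ w in 𝓝[D] z, |F w - F z| ≤ r * ‖w - z‖) :
    F y - F x ≤ c * quasihyperbolicDist D x y := by
  rw [← div_le_iff₀' hc]
  refine le_quasihyperbolicDist hxy fun φ L h => ?_
  rw [div_le_iff₀' hc]
  set ρ : E → ℝ := fun z => 1 / infDist z (frontier D) with hρdef
  have hρφ : ContinuousOn (fun u => ρ (φ u)) (Icc 0 L) :=
    h.continuousOn_comp (continuousOn_one_div_infDist hD)
  have hφt : ∀ u ∈ Icc 0 L, Tendsto φ (𝓝[Icc 0 L] u) (𝓝[D] (φ u)) := fun u hu =>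
    tendsto_nhdsWithin_iff.2 ⟨h.unitSpeed.continuousOn u hu,
      eventually_mem_nhdsWithin.mono fun v hv => h.mapsTo hv⟩
  have hev : ∀ u ∈ Icc 0 L, ∀ r, c * ρ (φ u) < r →
      ∀ᶠ v in 𝓝[Icc 0 L] u, |F (φ v) - F (φ u)| ≤ r * |v - u| := by
    intro u hu r hr
    have hr' : c / infDist (φ u) (frontier D) < r := by
      simpa [hρdef, div_eq_mul_inv] using hr
    have hr0 : 0 ≤ r := le_trans (by have := hD _ (h.mapsTo hu); positivity) hr'.le
    filter_upwards [(hφt u hu).eventually (hF _ (h.mapsTo hu) r hr'), eventually_mem_nhdsWithin]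
      with v hv hvm
    exact hv.trans (mul_le_mul_of_nonneg_left (h.unitSpeed.norm_sub_le hvm hu) hr0)
  have hcont : ContinuousOn (fun u => F (φ u) - F x) (Icc 0 L) := by
    intro u hu
    refine ContinuousWithinAt.sub ?_ continuousWithinAt_const
    rw [ContinuousWithinAt, tendsto_iff_dist_tendsto_zero]
    have ht : Tendsto (fun v => (c * ρ (φ u) + 1) * |v - u|) (𝓝[Icc 0 L] u) (𝓝 0) := by
      have : Continuous fun v => (c * ρ (φ u) + 1) * |v - u| := by fun_prop
      simpa using (this.tendsto u).mono_left nhdsWithin_le_nhds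
    refine squeeze_zero' (Eventually.of_forall fun _ => dist_nonneg) ?_ ht
    filter_upwards [hev u hu (c * ρ (φ u) + 1) (by linarith)] with v hv
    rwa [Real.dist_eq]
  have hint : ∀ u ∈ Icc 0 L, IntervalIntegrable (fun u => ρ (φ u)) volume 0 u := fun u hu => by
    refine (hρφ.mono ?_).intervalIntegrable
    rw [uIcc_of_le hu.1]
    exact Icc_subset_Icc_right hu.2
  have hder : ∀ u ∈ Ico 0 L, HasDerivWithinAt (fun u => c * ∫ v in (0 : ℝ)..u, ρ (φ v))
      (c * ρ (φ u)) (Ici u) u := by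
    intro u hu
    refine HasDerivWithinAt.const_mul c ?_
    have hcu : ContinuousWithinAt (fun u => ρ (φ u)) (Ioi u) u := by
      refine ((hρφ u ⟨hu.1, hu.2.le⟩).mono_of_mem_nhdsWithin ?_)
      exact mem_of_superset (Ioo_mem_nhdsGT hu.2) fun v hv => ⟨hu.1.trans hv.1.le, hv.2.le⟩
    refine intervalIntegral.integral_hasDerivWithinAt_right (hint u ⟨hu.1, hu.2.le⟩) ?_ hcu
    refine ⟨Ioo u L, Ioo_mem_nhdsGT hu.2, ?_⟩
    exact (hρφ.mono fun v hv => ⟨hu.1.trans hv.1.le, hv.2.le⟩).aestronglyMeasurable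
      measurableSet_Ioo
  have hBc : ContinuousOn (fun u => c * ∫ v in (0 : ℝ)..u, ρ (φ v)) (Icc 0 L) := by
    refine continuousOn_const.mul ?_
    have := intervalIntegral.continuousOn_primitive_interval' (hint L ⟨h.nonneg, le_rfl⟩)
      (left_mem_uIcc)
    rwa [uIcc_of_le h.nonneg] at this
  -- Neither `F` nor the curve need be differentiable. It suffices that the right difference
  -- quotients of `F ∘ φ` are asymptotically at most `c * ρ (φ u)`, the right derivative of the
  -- weighted length.
  have := image_le_of_liminf_slope_right_le_deriv_boundary hcont
    (B := fun u => c * ∫ v in (0 : ℝ)..u, ρ (φ v)) (B' := fun u => c * ρ (φ u))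
    (by simp [h.source]) hBc hder ?_ (⟨h.nonneg, le_rfl⟩ : L ∈ Icc 0 L)
  · simpa [h.target, hρdef] using this
  · intro u hu r hr
    obtain ⟨r', hr1, hr2⟩ := exists_between hr
    have hsub : 𝓝[>] u ≤ 𝓝[Icc 0 L] u :=
      nhdsWithin_le_of_mem (mem_of_superset (Ioo_mem_nhdsGT hu.2)
        fun v hv => ⟨hu.1.trans hv.1.le, hv.2.le⟩)
    refine Eventually.frequently ?_
    filter_upwards [hsub (hev u ⟨hu.1, hu.2.le⟩ r' hr1), self_mem_nhdsWithin] with v hv huv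
    have huv' : 0 < v - u := sub_pos.2 huv
    rw [slope_def_field, div_lt_iff₀ huv']
    have h1 : |F (φ v) - F (φ u)| ≤ r' * |v - u| := hv
    rw [abs_of_pos huv'] at h1
    have h2 := le_abs_self (F (φ v) - F (φ u))
    nlinarith

variable [NormedSpace ℝ E]

theorem exists_isUnitSpeedCurveIn_of_segment_subset (h : segment ℝ x y ⊆ D) :
    ∃ φ : ℝ → E, IsUnitSpeedCurveIn D x y φ ‖y - x‖ ∧
      ∀ u ∈ Icc 0 ‖y - x‖, φ u ∈ segment ℝ x y := by
  set L := ‖y - x‖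
  have hmem : ∀ u ∈ Icc 0 L, x + (u / L) • (y - x) ∈ segment ℝ x y := by
    intro u hu
    rw [segment_eq_image']
    exact ⟨u / L, ⟨div_nonneg hu.1 (norm_nonneg _), div_le_one_of_le₀ hu.2 (norm_nonneg _)⟩, rfl⟩
  refine ⟨fun u => x + (u / L) • (y - x), ⟨norm_nonneg _, ?_, fun u hu => h (hmem u hu),
    by simp, ?_⟩, hmem⟩
  · rcases (norm_nonneg (y - x)).eq_or_lt with h0 | h0
    -- If `x = y`, then `u / L = 0` by convention and the domain is the single point `0`.
    · exact hasConstantSpeedOnWith_of_subsingleton _ (by simp [L, ← h0]) 1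
    refine hasConstantSpeedOnWith_iff_ordered.2 fun u hu v hv huv => ?_
    have hd : ∀ a b : ℝ, edist (x + (a / L) • (y - x)) (x + (b / L) • (y - x)) = edist a b := by
      intro a b
      rw [edist_dist, edist_dist, dist_add_left, dist_eq_norm, ← sub_smul, norm_smul, ← sub_div,
        norm_div, norm_norm, div_mul_cancel₀ _ h0.ne', ← dist_eq_norm]
    have : eVariationOn (fun u : ℝ => x + (u / L) • (y - x)) (Icc 0 L ∩ Icc u v) =
        eVariationOn (id : ℝ → ℝ) (Icc 0 L ∩ Icc u v) := by
      simp only [eVariationOn, hd, id]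
    rw [this, eVariationOn_id (a := u) (b := v) hu hv]
    simp
  · rcases (norm_nonneg (y - x)).eq_or_lt with h0 | h0
    · have : y - x = 0 := norm_eq_zero.1 h0.symm
      simp [sub_eq_zero.1 this]
    · simp [L, div_self h0.ne']

theorem quasihyperbolicDist_le_of_segment (h : segment ℝ x y ⊆ D) {m : ℝ} (hm : 0 < m)
    (hmle : ∀ z ∈ segment ℝ x y, m ≤ infDist z (frontier D)) :
    quasihyperbolicDist D x y ≤ ‖y - x‖ / m := by
  obtain ⟨φ, hφ, hs⟩ := exists_isUnitSpeedCurveIn_of_segment_subset h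
  refine hφ.quasihyperbolicDist_le.trans ?_
  have hb : ∀ u ∈ Ι 0 ‖y - x‖, ‖1 / infDist (φ u) (frontier D)‖ ≤ 1 / m := fun u hu => by
    rw [uIoc_of_le (norm_nonneg _)] at hu
    rw [Real.norm_of_nonneg (one_div_nonneg.2 infDist_nonneg)]
    exact one_div_le_one_div_of_le hm (hmle _ (hs u ⟨hu.1.le, hu.2⟩))
  refine (le_abs_self _).trans ((intervalIntegral.norm_integral_le_of_norm_le_const hb).trans ?_)
  rw [sub_zero, abs_of_nonneg (norm_nonneg _)]
  apply le_of_eq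
  ring

end Curves

/-! ### Distance distortion of Möbius transformations -/

section MobiusDistortion

theorem exists_norm_eq_one_smul_eq {E : Type*} [NormedAddCommGroup E] [NormedSpace ℝ E]
    [Nontrivial E] (x : E) : ∃ e : E, ‖e‖ = 1 ∧ x = ‖x‖ • e := by
  by_cases h : x = 0
  · obtain ⟨e, he⟩ := exists_norm_eq E zero_le_one
    exact ⟨e, he, by simp [h]⟩
  · have hn := norm_ne_zero_iff.2 h
    exact ⟨‖x‖⁻¹ • x, by rw [norm_smul, norm_inv, norm_norm, inv_mul_cancel₀ hn],
      by rw [smul_smul, mul_inv_cancel₀ hn, one_smul]⟩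

variable {E : Type*} [NormedAddCommGroup E]

/-- The squared distance on `E ∪ {∞}`, normalized so that Möbius transformations distort it by a
product of two factors, one for each point. -/
def sqDistExt : OnePoint E → OnePoint E → ℝ
  | none, none => 0
  | none, some _ => 1
  | some _, none => 1
  | some x, some y => ‖x - y‖ ^ 2

@[simp] theorem sqDistExt_infty_infty : sqDistExt (OnePoint.infty : OnePoint E) OnePoint.infty = 0 :=
  rfl

@[simp] theorem sqDistExt_infty_coe (x : E) : sqDistExt OnePoint.infty (x : OnePoint E) = 1 := rfl

@[simp] theorem sqDistExt_coe_infty (x : E) : sqDistExt (x : OnePoint E) OnePoint.infty = 1 := rfl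

@[simp] theorem sqDistExt_coe_coe (x y : E) :
    sqDistExt (x : OnePoint E) (y : OnePoint E) = ‖x - y‖ ^ 2 := rfl

variable [InnerProductSpace ℝ E]

@[simp] theorem sphereInversion_infty (c : E) {r : ℝ} (hr : 0 < r) :
    sphereInversion c r hr OnePoint.infty = (c : OnePoint E) := rfl

@[simp] theorem sphereInversion_center (c : E) {r : ℝ} (hr : 0 < r) :
    sphereInversion c r hr (c : OnePoint E) = OnePoint.infty := if_pos rfl

theorem sphereInversion_coe {c : E} {r : ℝ} (hr : 0 < r) {x : E} (hx : x ≠ c) :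
    sphereInversion c r hr (x : OnePoint E) = (EuclideanGeometry.inversion c r x : E) := if_neg hx

@[simp] theorem hyperplaneReflection_infty (p v : E) :
    hyperplaneReflection p v OnePoint.infty = OnePoint.infty := rfl

@[simp] theorem hyperplaneReflection_coe (p v x : E) : hyperplaneReflection p v (x : OnePoint E) =
    ((Submodule.span ℝ {v})ᗮ.reflection (x - p) + p : E) := rfl

theorem norm_inversion_sub_inversion_sq {c x y : E} (r : ℝ) (hx : x ≠ c) (hy : y ≠ c) :
    ‖EuclideanGeometry.inversion c r x - EuclideanGeometry.inversion c r y‖ ^ 2 =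
      r ^ 2 / ‖x - c‖ ^ 2 * (r ^ 2 / ‖y - c‖ ^ 2) * ‖x - y‖ ^ 2 := by
  have := EuclideanGeometry.dist_inversion_inversion hx hy r
  simp only [dist_eq_norm] at this
  rw [this]
  have h1 : ‖x - c‖ ≠ 0 := norm_ne_zero_iff.2 (sub_ne_zero.2 hx)
  have h2 : ‖y - c‖ ≠ 0 := norm_ne_zero_iff.2 (sub_ne_zero.2 hy)
  field_simp

theorem norm_inversion_sub_center_sq {c x : E} (r : ℝ) (hx : x ≠ c) :
    ‖EuclideanGeometry.inversion c r x - c‖ ^ 2 = r ^ 2 / ‖x - c‖ ^ 2 * r ^ 2 := by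
  have := EuclideanGeometry.dist_inversion_center c x r
  simp only [dist_eq_norm] at this
  rw [this]
  have h1 : ‖x - c‖ ≠ 0 := norm_ne_zero_iff.2 (sub_ne_zero.2 hx)
  field_simp

open Classical in
theorem exists_distortion_sphereInversion (c : E) {r : ℝ} (hr : 0 < r) :
    ∃ μ : OnePoint E → ℝ, (∀ x, 0 < μ x) ∧ ∀ x y,
      sqDistExt (sphereInversion c r hr x) (sphereInversion c r hr y) =
        μ x * μ y * sqDistExt x y := by
  -- At finite points other than `c` this is the usual factor. The value `r ^ 2` at `∞` is dictated
  -- by `|I x - c|² = r⁴ / |x - c|²`, where `I` is the inversion, and `1 / r ^ 2` at `c` by the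
  -- interchange of `c` and `∞`.
  refine ⟨fun x => x.elim (r ^ 2) fun x => if x = c then 1 / r ^ 2 else r ^ 2 / ‖x - c‖ ^ 2,
    fun x => ?_, fun x y => ?_⟩
  · induction x using OnePoint.rec with
    | infty => exact pow_pos hr 2
    | coe x =>
      change 0 < if x = c then 1 / r ^ 2 else r ^ 2 / ‖x - c‖ ^ 2
      split_ifs with h
      · positivity
      · have : 0 < ‖x - c‖ := norm_pos_iff.2 (sub_ne_zero.2 h)
        positivity
  · have hn : ∀ x : E, x ≠ c → ‖x - c‖ ≠ 0 := fun x h => norm_ne_zero_iff.2 (sub_ne_zero.2 h)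
    induction x using OnePoint.rec with
    | infty =>
      induction y using OnePoint.rec with
      | infty => simp
      | coe y =>
        by_cases hy : y = c
        · subst hy
          simp [hr.ne']
        · have := norm_inversion_sub_center_sq r hy
          rw [norm_sub_rev] at this
          simp [sphereInversion_coe hr hy, hy, this, mul_comm]
    | coe x =>
      induction y using OnePoint.rec with
      | infty =>
        by_cases hx : x = c
        · subst hx
          simp [hr.ne']
        · simp [sphereInversion_coe hr hx, hx, norm_inversion_sub_center_sq r hx]
      | coe y =>
        by_cases hx : x = c
        · subst hx
          by_cases hy : y = x
          · subst hy
            simp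
          · have := hn y hy
            simp only [sphereInversion_center, sphereInversion_coe hr hy, sqDistExt_infty_coe,
              sqDistExt_coe_coe, OnePoint.elim_some, if_true, if_neg hy, norm_sub_rev x y]
            field_simp
        · by_cases hy : y = c
          · subst hy
            have := hn x hx
            simp only [sphereInversion_center, sphereInversion_coe hr hx, sqDistExt_coe_infty,
              sqDistExt_coe_coe, OnePoint.elim_some, if_true, if_neg hx]
            field_simp
          · simp [sphereInversion_coe hr hx, sphereInversion_coe hr hy, hx, hy,
              norm_inversion_sub_inversion_sq r hx hy]

/-- A Möbius transformation distorts squared distances by a product of two positive factors. -/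
theorem exists_distortion_of_mem_mobiusGroup {g : Equiv.Perm (OnePoint E)}
    (hg : g ∈ mobiusGroup E) : ∃ μ : OnePoint E → ℝ, (∀ x, 0 < μ x) ∧ ∀ x y,
      sqDistExt (g x) (g y) = μ x * μ y * sqDistExt x y := by
  induction hg using Subgroup.closure_induction with
  | mem g hg =>
    rcases hg with ⟨c, r, hr, rfl⟩ | ⟨p, v, -, rfl⟩
    · exact exists_distortion_sphereInversion c hr
    · refine ⟨fun _ => 1, fun _ => one_pos, fun x y => ?_⟩
      induction x using OnePoint.rec <;> induction y using OnePoint.rec <;>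
        simp [← map_sub]
  | one => exact ⟨fun _ => 1, fun _ => one_pos, fun x y => by simp⟩
  | mul g g' _ _ h h' =>
    obtain ⟨μ, hμ, H⟩ := h
    obtain ⟨μ', hμ', H'⟩ := h'
    refine ⟨fun x => μ (g' x) * μ' x, fun x => mul_pos (hμ _) (hμ' _), fun x y => ?_⟩
    rw [Equiv.Perm.mul_apply, Equiv.Perm.mul_apply, H, H']
    ring
  | inv g _ h =>
    obtain ⟨μ, hμ, H⟩ := h
    refine ⟨fun x => (μ (g⁻¹ x))⁻¹, fun x => inv_pos.2 (hμ _), fun x y => ?_⟩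
    have := H (g⁻¹ x) (g⁻¹ y)
    rw [show g (g⁻¹ x) = x from g.apply_symm_apply x,
      show g (g⁻¹ y) = y from g.apply_symm_apply y] at this
    rw [this]
    have h1 := (hμ (g⁻¹ x)).ne'
    have h2 := (hμ (g⁻¹ y)).ne'
    field_simp

/-- For `|w| = 1` and `v = T w` finite, the identity reads `|x' - v|² / |v|² = κ |x - w|²`. As `|v|
≥ 1`, the left side lies between `(1 - |x'|)²` and `(1 + |x'|)²`; for `v = ∞` it becomes `1`. The
points `w` on the sphere nearest to and farthest from `x` give the two bounds. Only `|v| ≥ 1` is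
used, so the sphere need not be known to be invariant. -/
theorem sq_bounds_of_distortion [Nontrivial E] {T : OnePoint E → OnePoint E}
    (hT : ∀ w : E, 1 ≤ ‖w‖ → ∀ v : E, T w = v → 1 ≤ ‖v‖) {x x' : E} (hx' : ‖x'‖ < 1) {κ : ℝ}
    (H : ∀ w, sqDistExt (x' : OnePoint E) (T w) * sqDistExt ((0 : E) : OnePoint E) w =
      κ * sqDistExt (x : OnePoint E) w * sqDistExt ((0 : E) : OnePoint E) (T w)) :
    (1 - ‖x'‖) ^ 2 ≤ κ * (1 - ‖x‖) ^ 2 ∧ κ * (1 + ‖x‖) ^ 2 ≤ (1 + ‖x'‖) ^ 2 := by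
  obtain ⟨e, he, hxe⟩ := exists_norm_eq_one_smul_eq x
  have bound : ∀ w : E, ‖w‖ = 1 →
      (1 - ‖x'‖) ^ 2 ≤ κ * ‖x - w‖ ^ 2 ∧ κ * ‖x - w‖ ^ 2 ≤ (1 + ‖x'‖) ^ 2 := by
    intro w hw
    have h1 := H w
    have h2 := hT w hw.ge
    generalize T w = v at h1 h2
    have h0 := norm_nonneg x'
    induction v using OnePoint.rec with
    | infty =>
      simp only [sqDistExt_coe_infty, sqDistExt_coe_coe, zero_sub, norm_neg, hw] at h1
      constructor <;> nlinarith
    | coe v =>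
      have hv : 1 ≤ ‖v‖ := h2 v rfl
      simp only [sqDistExt_coe_coe, zero_sub, norm_neg, hw, one_pow, mul_one] at h1
      have hv2 : 0 < ‖v‖ ^ 2 := by positivity
      have t1 : ‖x' - v‖ ≤ (1 + ‖x'‖) * ‖v‖ := by nlinarith [norm_sub_le x' v]
      have t2 : (1 - ‖x'‖) * ‖v‖ ≤ ‖x' - v‖ := by
        nlinarith [norm_sub_norm_le v x', norm_sub_rev v x']
      have t3 : 0 ≤ (1 - ‖x'‖) * ‖v‖ := by
        have : 0 ≤ 1 - ‖x'‖ := by linarith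
        positivity
      have s1 := pow_le_pow_left₀ (norm_nonneg _) t1 2
      have s2 := pow_le_pow_left₀ t3 t2 2
      rw [h1, mul_pow] at s1 s2
      exact ⟨le_of_mul_le_mul_right s2 hv2, le_of_mul_le_mul_right s1 hv2⟩
  have e1 : ‖x - e‖ ^ 2 = (1 - ‖x‖) ^ 2 := by
    have : x - e = (‖x‖ - 1) • e := by rw [sub_smul, one_smul, ← hxe]
    rw [this, norm_smul, he, mul_one, Real.norm_eq_abs, sq_abs]
    ring
  have e2 : ‖x - -e‖ ^ 2 = (1 + ‖x‖) ^ 2 := by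
    have : x - -e = (‖x‖ + 1) • e := by rw [add_smul, one_smul, ← hxe, sub_neg_eq_add]
    rw [this, norm_smul, he, mul_one, Real.norm_eq_abs, sq_abs]
    ring
  exact ⟨e1 ▸ (bound e he).1, e2 ▸ (bound (-e) (by rwa [norm_neg])).2⟩

/-- A Möbius transformation that preserves the unit ball and fixes the origin acts on the ball as
a linear isometry. -/
theorem norm_sub_eq_of_mem_mobiusGroup_of_fixes_zero [Nontrivial E] {g : Equiv.Perm (OnePoint E)}
    (hg : g ∈ mobiusGroup E)
    (hball : ∀ z, g z ∈ ((↑) '' ball (0 : E) 1 : Set (OnePoint E)) ↔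
      z ∈ ((↑) '' ball (0 : E) 1 : Set (OnePoint E)))
    (hg0 : g ((0 : E) : OnePoint E) = ((0 : E) : OnePoint E)) {x x' y y' : E}
    (hx : x ∈ ball (0 : E) 1) (hy : y ∈ ball (0 : E) 1) (hx' : g x = x') (hy' : g y = y') :
    ‖x'‖ = ‖x‖ ∧ ‖x' - y'‖ = ‖x - y‖ := by
  obtain ⟨μ, hμ, H⟩ := exists_distortion_of_mem_mobiusGroup hg
  have hmem : ∀ v : E, (v : OnePoint E) ∈ ((↑) '' ball (0 : E) 1 : Set (OnePoint E)) ↔ ‖v‖ < 1 := by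
    simp
  have hinv : ∀ w, g (g⁻¹ w) = w := g.apply_symm_apply
  set μ₀ := μ ((0 : E) : OnePoint E) with hμ₀
  have hp₀ : 0 < μ₀ := hμ _
  have main : ∀ x x' : E, ‖x‖ < 1 → g x = x' → ‖x'‖ = ‖x‖ ∧ μ x = μ₀ := by
    intro x x' hx hx'
    have hx'1 : ‖x'‖ < 1 := by
      rw [← hmem, ← hx', hball, hmem]
      exact hx
    have hκ : 0 < μ x / μ₀ := div_pos (hμ _) (hμ _)
    have H1 : ∀ w, sqDistExt (x' : OnePoint E) (g w) * sqDistExt ((0 : E) : OnePoint E) w =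
        μ x / μ₀ * sqDistExt (x : OnePoint E) w * sqDistExt ((0 : E) : OnePoint E) (g w) := by
      intro w
      have a1 := H x w
      have a2 := H ((0 : E) : OnePoint E) w
      rw [hg0] at a2
      rw [hx'] at a1
      rw [a1, a2, ← hμ₀]
      field_simp
    have H2 : ∀ w, sqDistExt (x : OnePoint E) (g⁻¹ w) * sqDistExt ((0 : E) : OnePoint E) w =
        (μ x / μ₀)⁻¹ * sqDistExt (x' : OnePoint E) w *
          sqDistExt ((0 : E) : OnePoint E) (g⁻¹ w) := by
      intro w
      have := H1 (g⁻¹ w)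
      rw [hinv] at this
      rw [mul_assoc, this, mul_assoc, inv_mul_cancel_left₀ hκ.ne']
    -- The bounds for `g` and those for its inverse, which has `κ⁻¹` in place of `κ`, are opposite
    -- inequalities. Together they are the equalities `√κ (1 ∓ |x|) = 1 ∓ |x'|`, whose sum forces `κ
    -- = 1`.
    obtain ⟨b1, b2⟩ := sq_bounds_of_distortion (T := g) (fun w hw v hv => by
      by_contra! hlt
      rw [← hmem, ← hv, hball, hmem] at hlt
      exact absurd hlt (not_lt.2 hw)) hx'1 H1
    obtain ⟨b3, b4⟩ := sq_bounds_of_distortion (T := ⇑g⁻¹) (fun w hw v hv => by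
      by_contra! hlt
      rw [← hmem, ← hball, ← hv, hinv, hmem] at hlt
      exact absurd hlt (not_lt.2 hw)) hx H2
    set κ := μ x / μ₀
    rw [← div_eq_inv_mul, le_div_iff₀' hκ] at b3
    rw [← div_eq_inv_mul, div_le_iff₀' hκ] at b4
    have s0 := Real.sqrt_pos.2 hκ
    have s1 := Real.sq_sqrt hκ.le
    have c1 : √κ * (1 - ‖x‖) = 1 - ‖x'‖ := by
      have : (√κ * (1 - ‖x‖)) ^ 2 = (1 - ‖x'‖) ^ 2 := by
        rw [mul_pow, s1]
        exact le_antisymm b3 b1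
      exact (pow_left_inj₀ (mul_nonneg s0.le (by linarith)) (by linarith) two_ne_zero).1 this
    have c2 : √κ * (1 + ‖x‖) = 1 + ‖x'‖ := by
      have : (√κ * (1 + ‖x‖)) ^ 2 = (1 + ‖x'‖) ^ 2 := by
        rw [mul_pow, s1]
        exact le_antisymm b2 b4
      exact (pow_left_inj₀ (mul_nonneg s0.le (by positivity)) (by positivity) two_ne_zero).1 this
    have c3 : √κ = 1 := by linarith
    rw [c3] at s1 c1
    refine ⟨by linarith, ?_⟩
    have : κ = 1 := by linarith
    rwa [div_eq_one_iff_eq hp₀.ne'] at this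
  rw [mem_ball_zero_iff] at hx hy
  obtain ⟨nx, mx⟩ := main x x' hx hx'
  obtain ⟨ny, my⟩ := main y y' hy hy'
  refine ⟨nx, ?_⟩
  have h1 := H x ((0 : E) : OnePoint E)
  have h2 := H x y
  rw [hx', hg0, mx] at h1
  rw [hx', hy', mx, my] at h2
  simp only [sqDistExt_coe_coe, sub_zero, ← hμ₀, nx] at h1 h2
  by_cases hx0 : ‖x‖ = 0
  · have hx'0 : x' = 0 := norm_eq_zero.1 (nx.trans hx0)
    rw [hx'0, norm_eq_zero.1 hx0]
    simpa using ny
  -- The factor is constant on the ball; comparing distances to the fixed origin determines it.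
  · have : μ₀ * μ₀ = 1 := by
      have h3 : ‖x‖ ^ 2 ≠ 0 := pow_ne_zero 2 hx0
      exact mul_right_cancel₀ h3 (by linarith)
    rw [this, one_mul] at h2
    exact (pow_left_inj₀ (norm_nonneg _) (norm_nonneg _) two_ne_zero).1 h2

/-- The behaviour of `1 - ‖x‖²` under inversion in a sphere orthogonal to the unit sphere. -/
theorem one_sub_norm_inversion_sq {c x : E} {r : ℝ} (hr : r ^ 2 = ‖c‖ ^ 2 - 1) (hx : x ≠ c) :
    1 - ‖EuclideanGeometry.inversion c r x‖ ^ 2 = r ^ 2 / ‖x - c‖ ^ 2 * (1 - ‖x‖ ^ 2) := by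
  have hd : ‖x - c‖ ^ 2 ≠ 0 := pow_ne_zero 2 (norm_ne_zero_iff.2 (sub_ne_zero.2 hx))
  have h1 : ‖x - c‖ ^ 2 = ‖x‖ ^ 2 - 2 * inner ℝ x c + ‖c‖ ^ 2 := norm_sub_sq_real x c
  have h2 : EuclideanGeometry.inversion c r x = (r ^ 2 / ‖x - c‖ ^ 2) • (x - c) + c := by
    simp only [EuclideanGeometry.inversion_def, vsub_eq_sub, vadd_eq_add, dist_eq_norm, div_pow]
  have ht : r ^ 2 / ‖x - c‖ ^ 2 * ‖x - c‖ ^ 2 = r ^ 2 := div_mul_cancel₀ _ hd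
  rw [h2]
  generalize r ^ 2 / ‖x - c‖ ^ 2 = t at *
  rw [norm_add_sq_real, norm_smul, real_inner_smul_left, inner_sub_left,
    real_inner_self_eq_norm_sq, mul_pow, Real.norm_eq_abs, sq_abs]
  linear_combination (1 - t) * ht - t * h1 + (1 - t) * hr

/-- Precomposing with an inversion that preserves the ball and exchanges `0` and `a` yields a map
fixing `0`, which preserves norms and distances in the ball. What remains is the identity for the
inversion, where the factors `r² / |x - c|²` cancel. -/
theorem IsMobiusSelfMap.norm_sub_sq [Nontrivial E] {h : E → E}
    (hmob : IsMobiusSelfMap (ball (0 : E) 1) h) {a : E} (ha : a ∈ ball (0 : E) 1) (h0 : h a = 0)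
    {x y : E} (hx : x ∈ ball (0 : E) 1) (hy : y ∈ ball (0 : E) 1) :
    ‖h x - h y‖ ^ 2 * ((1 - ‖x‖ ^ 2) * (1 - ‖y‖ ^ 2)) =
      ‖x - y‖ ^ 2 * ((1 - ‖h x‖ ^ 2) * (1 - ‖h y‖ ^ 2)) := by
  obtain ⟨himg, g, hg, hgh⟩ := hmob
  have hball : ∀ z, g z ∈ ((↑) '' ball (0 : E) 1 : Set (OnePoint E)) ↔
      z ∈ ((↑) '' ball (0 : E) 1 : Set (OnePoint E)) := by
    intro z
    constructor
    · rintro ⟨w, hw, hwz⟩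
      rw [← himg] at hw
      obtain ⟨v, hv, rfl⟩ := hw
      rw [← hgh v hv] at hwz
      exact ⟨v, hv, g.injective hwz⟩
    · rintro ⟨w, hw, rfl⟩
      exact ⟨h w, himg ▸ mem_image_of_mem h hw, (hgh w hw).symm⟩
  have hga : g (a : OnePoint E) = ((0 : E) : OnePoint E) := by rw [hgh a ha, h0]
  by_cases ha0 : a = 0
  · subst ha0
    obtain ⟨e1, e2⟩ := norm_sub_eq_of_mem_mobiusGroup_of_fixes_zero hg hball hga hx hy
      (hgh x hx) (hgh y hy)
    obtain ⟨e3, -⟩ := norm_sub_eq_of_mem_mobiusGroup_of_fixes_zero hg hball hga hy hx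
      (hgh y hy) (hgh x hx)
    rw [e1, e2, e3]
  have ha1 : ‖a‖ < 1 := mem_ball_zero_iff.1 ha
  have hapos : 0 < ‖a‖ := norm_pos_iff.2 ha0
  -- `c` is the mirror image of `a` in the unit sphere, and `r² = |c|² - 1` makes the sphere of
  -- inversion orthogonal to the unit sphere. For `a = 0` this centre would be `∞`, hence the
  -- separate case.
  set c : E := (‖a‖ ^ 2)⁻¹ • a with hc
  have hcn : ‖c‖ = ‖a‖⁻¹ := by
    rw [hc, norm_smul, norm_inv, norm_pow, norm_norm]
    field_simp
  have hc1 : 1 < ‖c‖ := hcn ▸ (one_lt_inv₀ hapos).2 ha1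
  have hrpos : 0 < ‖c‖ ^ 2 - 1 := by nlinarith
  set r := √(‖c‖ ^ 2 - 1)
  have hr0 : 0 < r := Real.sqrt_pos.2 hrpos
  have hr : r ^ 2 = ‖c‖ ^ 2 - 1 := Real.sq_sqrt hrpos.le
  have hne : ∀ x : E, x ∈ ball (0 : E) 1 → x ≠ c := by
    rintro x hx rfl
    exact absurd (mem_ball_zero_iff.1 hx) (not_lt.2 hc1.le)
  set I : E → E := EuclideanGeometry.inversion c r
  have hI : ∀ x ∈ ball (0 : E) 1, I x ∈ ball (0 : E) 1 := by
    intro x hx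
    have h1 := one_sub_norm_inversion_sq hr (hne x hx)
    have h2 : 0 < ‖x - c‖ := norm_pos_iff.2 (sub_ne_zero.2 (hne x hx))
    rw [mem_ball_zero_iff] at hx ⊢
    have h3 : 0 < 1 - ‖x‖ ^ 2 := by nlinarith [norm_nonneg x]
    have h4 : 0 < 1 - ‖I x‖ ^ 2 := by rw [h1]; positivity
    nlinarith [norm_nonneg (I x)]
  set J := sphereInversion c r hr0 with hJ
  have hJc : ∀ x ∈ ball (0 : E) 1, J (x : OnePoint E) = (I x : E) := fun x hx =>
    sphereInversion_coe hr0 (hne x hx)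
  have hJJ : ∀ z, J (J z) = z := sphereInversionFun_involutive c hr0
  have hJball : ∀ z, J z ∈ ((↑) '' ball (0 : E) 1 : Set (OnePoint E)) ↔
      z ∈ ((↑) '' ball (0 : E) 1 : Set (OnePoint E)) := by
    have : ∀ z, z ∈ ((↑) '' ball (0 : E) 1 : Set (OnePoint E)) →
        J z ∈ ((↑) '' ball (0 : E) 1 : Set (OnePoint E)) := by
      rintro _ ⟨w, hw, rfl⟩
      exact ⟨I w, hI w hw, (hJc w hw).symm⟩
    exact fun z => ⟨fun hz => hJJ z ▸ this _ hz, this z⟩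
  have hI0 : I 0 = a := by
    simp only [I, EuclideanGeometry.inversion_def, vsub_eq_sub, vadd_eq_add, dist_eq_norm, zero_sub,
      norm_neg, smul_neg, div_pow, hr]
    rw [sub_div, div_self (by positivity), sub_smul, one_smul, neg_sub, sub_add_cancel, hcn, hc,
      smul_smul]
    have : 1 / ‖a‖⁻¹ ^ 2 * (‖a‖ ^ 2)⁻¹ = 1 := by field_simp
    rw [this, one_smul]
  have hJmem : J ∈ mobiusGroup E := Subgroup.subset_closure (Or.inl ⟨c, r, hr0, rfl⟩)
  have hgJ0 : (g * J) ((0 : E) : OnePoint E) = ((0 : E) : OnePoint E) := by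
    rw [Equiv.Perm.mul_apply, hJc 0 (mem_ball_self one_pos), hI0, hga]
  have hgJ : ∀ x ∈ ball (0 : E) 1, (g * J) (I x : E) = (h x : E) := by
    intro x hx
    rw [Equiv.Perm.mul_apply, ← hJc x hx, hJJ, hgh x hx]
  have hgJball : ∀ z, (g * J) z ∈ ((↑) '' ball (0 : E) 1 : Set (OnePoint E)) ↔
      z ∈ ((↑) '' ball (0 : E) 1 : Set (OnePoint E)) := fun z => (hball _).trans (hJball z)
  obtain ⟨e1, e2⟩ := norm_sub_eq_of_mem_mobiusGroup_of_fixes_zero (mul_mem hg hJmem) hgJball hgJ0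
    (hI x hx) (hI y hy) (hgJ x hx) (hgJ y hy)
  obtain ⟨e3, -⟩ := norm_sub_eq_of_mem_mobiusGroup_of_fixes_zero (mul_mem hg hJmem) hgJball hgJ0
    (hI y hy) (hI x hx) (hgJ y hy) (hgJ x hx)
  rw [e1, e2, e3, norm_inversion_sub_inversion_sq r (hne x hx) (hne y hy),
    one_sub_norm_inversion_sq hr (hne x hx), one_sub_norm_inversion_sq hr (hne y hy)]
  ring

end MobiusDistortion

/-! ### Quasihyperbolic estimates in the unit ball -/

section UnitBall

open Filter Topology

variable {E : Type*} [NormedAddCommGroup E]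

/-- `f` is a bijection of the unit ball with inverse `g` which satisfies the distance formula of
the isometries of the Poincaré metric. -/
structure IsHyperbolicIsometry (f g : E → E) : Prop where
  mapsTo : MapsTo f (ball (0 : E) 1) (ball (0 : E) 1)
  mapsTo_inv : MapsTo g (ball (0 : E) 1) (ball (0 : E) 1)
  leftInv : ∀ x ∈ ball (0 : E) 1, g (f x) = x
  rightInv : ∀ x ∈ ball (0 : E) 1, f (g x) = x
  norm_sub_sq : ∀ x ∈ ball (0 : E) 1, ∀ y ∈ ball (0 : E) 1,
    ‖f x - f y‖ ^ 2 * ((1 - ‖x‖ ^ 2) * (1 - ‖y‖ ^ 2)) =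
      ‖x - y‖ ^ 2 * ((1 - ‖f x‖ ^ 2) * (1 - ‖f y‖ ^ 2))

theorem one_sub_norm_sq_pos {x : E} (hx : x ∈ ball (0 : E) 1) : 0 < 1 - ‖x‖ ^ 2 := by
  rw [mem_ball_zero_iff] at hx
  nlinarith [norm_nonneg x]

namespace IsHyperbolicIsometry

variable {f g : E → E}

theorem symm (h : IsHyperbolicIsometry f g) : IsHyperbolicIsometry g f where
  mapsTo := h.mapsTo_inv
  mapsTo_inv := h.mapsTo
  leftInv := h.rightInv
  rightInv := h.leftInv
  norm_sub_sq x hx y hy := by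
    have := h.norm_sub_sq _ (h.mapsTo_inv hx) _ (h.mapsTo_inv hy)
    rw [h.rightInv x hx, h.rightInv y hy] at this
    exact this.symm

theorem continuousOn (h : IsHyperbolicIsometry f g) : ContinuousOn f (ball (0 : E) 1) := by
  intro z hz
  have hz1 := one_sub_norm_sq_pos hz
  rw [ContinuousWithinAt, tendsto_iff_norm_sub_tendsto_zero]
  have ht : Tendsto (fun w => √(‖w - z‖ ^ 2 / ((1 - ‖w‖ ^ 2) * (1 - ‖z‖ ^ 2))))
      (𝓝[ball (0 : E) 1] z) (𝓝 0) := by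
    have : ContinuousAt (fun w => √(‖w - z‖ ^ 2 / ((1 - ‖w‖ ^ 2) * (1 - ‖z‖ ^ 2)))) z := by
      refine ContinuousAt.sqrt (ContinuousAt.div (by fun_prop) (by fun_prop) ?_)
      positivity
    simpa using this.tendsto.mono_left nhdsWithin_le_nhds
  refine squeeze_zero' (Eventually.of_forall fun _ => norm_nonneg _) ?_ ht
  filter_upwards [self_mem_nhdsWithin] with w hw
  have hw1 := one_sub_norm_sq_pos hw
  apply Real.le_sqrt_of_sq_le
  rw [le_div_iff₀ (by positivity), h.norm_sub_sq w hw z hz]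
  -- The factors `1 - |f w|²` and `1 - |f z|²` are at most `1`.
  refine mul_le_of_le_one_right (by positivity) ?_
  exact mul_le_one₀ (by nlinarith) (one_sub_norm_sq_pos (h.mapsTo hz)).le (by nlinarith)

theorem norm_map_zero (h : IsHyperbolicIsometry f g) {a : E} (ha : a ∈ ball (0 : E) 1)
    (h0 : f a = 0) : ‖f 0‖ = ‖a‖ := by
  have := h.norm_sub_sq 0 (mem_ball_self one_pos) a ha
  simp only [h0, sub_zero, zero_sub, norm_zero, norm_neg] at this
  exact (pow_left_inj₀ (norm_nonneg _) (norm_nonneg _) two_ne_zero).1 (by linarith)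

/-- With `u = |f x|`, `s = |x|`, `t = |a|`, the distance identity gives `u² (1 - s²)(1 - t²) = |x -
a|² (1 - u²) ≤ (s + t)² (1 - u²)`. Since `(1 - s²)(1 - t²) ≥ 1 - (s + t)²`, this forces `u ≤ s + t`.
-/
theorem one_add_norm_le (h : IsHyperbolicIsometry f g) {a x : E} (ha : a ∈ ball (0 : E) 1)
    (h0 : f a = 0) (hx : x ∈ ball (0 : E) 1) : 1 + ‖f x‖ ≤ (1 + ‖a‖) * (1 + ‖x‖) := by
  have H := h.norm_sub_sq x hx a ha
  rw [h0, sub_zero, norm_zero] at H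
  have hd : ‖x - a‖ ≤ ‖x‖ + ‖a‖ := norm_sub_le x a
  have hu1 := one_sub_norm_sq_pos (h.mapsTo hx)
  have ha1 := one_sub_norm_sq_pos ha
  have hs := norm_nonneg x
  have ht := norm_nonneg a
  have hd0 := norm_nonneg (x - a)
  suffices ‖f x‖ ≤ ‖x‖ + ‖a‖ by nlinarith
  generalize ‖f x‖ = u at *
  generalize ‖x - a‖ = d at *
  generalize ‖x‖ = s at *
  generalize ‖a‖ = t at *
  by_contra! hlt
  have hp : 0 ≤ s + t := by positivity
  have h1 : d ^ 2 ≤ (s + t) ^ 2 := pow_le_pow_left₀ hd0 hd 2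
  have h2 : (s + t) ^ 2 < u ^ 2 := pow_lt_pow_left₀ hlt hp two_ne_zero
  have hK : 1 - (s + t) ^ 2 ≤ (1 - s ^ 2) * (1 - t ^ 2) := by
    nlinarith [mul_nonneg hs ht, sq_nonneg (s * t)]
  have h3 : d ^ 2 * (1 - u ^ 2) ≤ (s + t) ^ 2 * (1 - u ^ 2) := by gcongr
  have h4 : u ^ 2 * (1 - (s + t) ^ 2) ≤ u ^ 2 * ((1 - s ^ 2) * (1 - t ^ 2)) := by gcongr
  nlinarith

end IsHyperbolicIsometry

variable [NormedSpace ℝ E]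

theorem infDist_frontier_unitBall [Nontrivial E] {z : E} (hz : z ∈ ball (0 : E) 1) :
    infDist z (frontier (ball (0 : E) 1)) = 1 - ‖z‖ := by
  rw [mem_ball_zero_iff] at hz
  rw [frontier_ball (0 : E) one_ne_zero]
  obtain ⟨e, he, hze⟩ := exists_norm_eq_one_smul_eq z
  have hmem : e ∈ sphere (0 : E) 1 := by simpa using he
  apply le_antisymm
  · refine (infDist_le_dist_of_mem hmem).trans_eq ?_
    have : z - e = (‖z‖ - 1) • e := by rw [sub_smul, one_smul, ← hze]
    rw [dist_eq_norm, this, norm_smul, he, mul_one, Real.norm_eq_abs, abs_sub_comm,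
      abs_of_pos (by linarith)]
  · refine (le_infDist ⟨e, hmem⟩).2 fun w hw => ?_
    rw [mem_sphere_zero_iff_norm] at hw
    rw [dist_comm, dist_eq_norm, ← hw]
    exact norm_sub_norm_le w z

theorem infDist_frontier_unitBall_pos [Nontrivial E] :
    ∀ z ∈ ball (0 : E) 1, 0 < infDist z (frontier (ball (0 : E) 1)) := fun z hz => by
  rw [infDist_frontier_unitBall hz]
  linarith [mem_ball_zero_iff.1 hz]

theorem exists_isUnitSpeedCurveIn_unitBall {x y : E} (hx : x ∈ ball (0 : E) 1)
    (hy : y ∈ ball (0 : E) 1) : ∃ φ L, IsUnitSpeedCurveIn (ball (0 : E) 1) x y φ L :=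
  let ⟨φ, h, _⟩ := exists_isUnitSpeedCurveIn_of_segment_subset
    ((convex_ball (0 : E) 1).segment_subset hx hy)
  ⟨φ, _, h⟩

variable [Nontrivial E]

theorem quasihyperbolicDist_unitBall_le {x y : E} (hx : x ∈ ball (0 : E) 1)
    (hy : y ∈ ball (0 : E) 1) :
    quasihyperbolicDist (ball (0 : E) 1) x y ≤ ‖y - x‖ / (1 - max ‖x‖ ‖y‖) := by
  have hseg := (convex_ball (0 : E) 1).segment_subset hx hy
  have hm : max ‖x‖ ‖y‖ < 1 := max_lt (mem_ball_zero_iff.1 hx) (mem_ball_zero_iff.1 hy)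
  refine quasihyperbolicDist_le_of_segment hseg (by linarith) fun z hz => ?_
  rw [infDist_frontier_unitBall (hseg hz)]
  have : z ∈ closedBall (0 : E) (max ‖x‖ ‖y‖) :=
    (convex_closedBall (0 : E) _).segment_subset (by simp) (by simp) hz
  linarith [mem_closedBall_zero_iff.1 this]

/-- A bound weaker than the logarithmic one, but exact to first order as `|q| → |p|` along a ray,
which suffices for sharpness. Truncating the norm at `|p|` discards the part of a curve where the
density is below `1 / (1 - |p|)`. -/
theorem div_le_quasihyperbolicDist_unitBall {p q : E} (hp : p ∈ ball (0 : E) 1)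
    (hq : q ∈ ball (0 : E) 1) (hpq : ‖p‖ ≤ ‖q‖) :
    (‖q‖ - ‖p‖) / (1 - ‖p‖) ≤ quasihyperbolicDist (ball (0 : E) 1) p q := by
  have hp1 : 0 < 1 - ‖p‖ := by linarith [mem_ball_zero_iff.1 hp]
  rw [div_le_iff₀' hp1]
  have := sub_le_mul_quasihyperbolicDist infDist_frontier_unitBall_pos
    (exists_isUnitSpeedCurveIn_unitBall hp hq) hp1 (F := fun z => max ‖z‖ ‖p‖) ?_
  · simpa [max_eq_left hpq] using this
  · intro z hz r hr
    rw [infDist_frontier_unitBall hz] at hr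
    have hz1 : 0 < 1 - ‖z‖ := by linarith [mem_ball_zero_iff.1 hz]
    rcases lt_or_ge ‖z‖ ‖p‖ with hzp | hzp
    · have hr0 : 0 < r := (div_pos hp1 hz1).trans hr
      have hev : ∀ᶠ w in 𝓝[ball (0 : E) 1] z, ‖w‖ < ‖p‖ :=
        (continuous_norm.continuousAt.eventually_lt_const hzp).filter_mono nhdsWithin_le_nhds
      filter_upwards [hev] with w hw
      rw [max_eq_right hw.le, max_eq_right hzp.le, sub_self, abs_zero]
      positivity
    · have hr1 : 1 ≤ r := by
        refine le_trans ?_ hr.le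
        rw [one_le_div hz1]
        linarith
      refine Eventually.of_forall fun w => ?_
      calc |max ‖w‖ ‖p‖ - max ‖z‖ ‖p‖| ≤ |‖w‖ - ‖z‖| := abs_max_sub_max_le_abs _ _ _
        _ ≤ ‖w - z‖ := abs_norm_sub_norm_le w z
        _ ≤ r * ‖w - z‖ := le_mul_of_one_le_left (norm_nonneg _) hr1

theorem abs_quasihyperbolicDist_unitBall_sub_le {x y z : E} (hx : x ∈ ball (0 : E) 1)
    (hy : y ∈ ball (0 : E) 1) (hz : z ∈ ball (0 : E) 1) :
    |quasihyperbolicDist (ball (0 : E) 1) x y - quasihyperbolicDist (ball (0 : E) 1) x z| ≤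
      ‖y - z‖ / (1 - max ‖y‖ ‖z‖) := by
  have tri := fun {u v w : E} (hu : u ∈ ball (0 : E) 1) (hv : v ∈ ball (0 : E) 1)
    (hw : w ∈ ball (0 : E) 1) => quasihyperbolicDist_triangle infDist_frontier_unitBall_pos
      (exists_isUnitSpeedCurveIn_unitBall hu hv) (exists_isUnitSpeedCurveIn_unitBall hv hw)
  have h1 := tri hx hz hy
  have h2 := tri hx hy hz
  have h3 := quasihyperbolicDist_unitBall_le hz hy
  have h4 := quasihyperbolicDist_unitBall_le hy hz
  rw [max_comm] at h3
  rw [norm_sub_rev] at h4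
  rw [abs_le]
  constructor <;> linarith

namespace IsHyperbolicIsometry

variable {f g : E → E}

theorem quasihyperbolicDist_map_le (h : IsHyperbolicIsometry f g) {a : E}
    (ha : a ∈ ball (0 : E) 1) (h0 : f a = 0) {x y : E} (hx : x ∈ ball (0 : E) 1)
    (hy : y ∈ ball (0 : E) 1) :
    quasihyperbolicDist (ball (0 : E) 1) (f x) (f y) ≤
      (1 + ‖a‖) * quasihyperbolicDist (ball (0 : E) 1) x y := by
  have hxx : quasihyperbolicDist (ball (0 : E) 1) (f x) (f x) ≤ 0 := by
    simpa using quasihyperbolicDist_unitBall_le (h.mapsTo hx) (h.mapsTo hx)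
  have := sub_le_mul_quasihyperbolicDist infDist_frontier_unitBall_pos
    (exists_isUnitSpeedCurveIn_unitBall hx hy) (c := 1 + ‖a‖) (by positivity)
    (F := fun z => quasihyperbolicDist (ball (0 : E) 1) (f x) (f z)) ?_
  · linarith
  intro z hz r hr
  rw [infDist_frontier_unitBall hz] at hr
  -- `q w` bounds the difference quotient of `F` between `w` and `z`. It is continuous at `z`, with
  -- `q z = (1 + |f z|) / (1 - |z|²) ≤ (1 + |a|) / (1 - |z|)`.
  set q : E → ℝ := fun w =>
    √((1 - ‖f w‖ ^ 2) * (1 - ‖f z‖ ^ 2) / ((1 - ‖w‖ ^ 2) * (1 - ‖z‖ ^ 2))) /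
      (1 - max ‖f w‖ ‖f z‖) with hq
  have hz1 := one_sub_norm_sq_pos hz
  have hfz := h.mapsTo hz
  have hfz1 := one_sub_norm_sq_pos hfz
  have hz2 : 0 < 1 - ‖z‖ := by linarith [mem_ball_zero_iff.1 hz]
  have hfz2 : 0 < 1 - ‖f z‖ := by linarith [mem_ball_zero_iff.1 hfz]
  have hqc : ContinuousWithinAt q (ball (0 : E) 1) z := by
    have hf : ContinuousWithinAt (fun w => ‖f w‖) (ball (0 : E) 1) z := (h.continuousOn z hz).norm
    have hid : ContinuousWithinAt (fun w : E => ‖w‖) (ball (0 : E) 1) z :=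
      continuous_norm.continuousWithinAt
    have c1 : ContinuousWithinAt (fun _ : E => (1 : ℝ)) (ball (0 : E) 1) z :=
      continuousWithinAt_const
    refine ContinuousWithinAt.div (ContinuousWithinAt.sqrt (ContinuousWithinAt.div
      ((c1.sub (hf.pow 2)).mul continuousWithinAt_const)
      ((c1.sub (hid.pow 2)).mul continuousWithinAt_const) ?_))
      (c1.sub (hf.max continuousWithinAt_const)) ?_
    · positivity
    · rw [max_self]
      exact hfz2.ne'
  have hqz : q z < r := by
    refine lt_of_le_of_lt ?_ hr
    have e1 : (1 - ‖f z‖ ^ 2) * (1 - ‖f z‖ ^ 2) / ((1 - ‖z‖ ^ 2) * (1 - ‖z‖ ^ 2)) =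
        ((1 - ‖f z‖ ^ 2) / (1 - ‖z‖ ^ 2)) ^ 2 := by
      field_simp
    have hn := norm_nonneg z
    simp only [hq]
    rw [e1, Real.sqrt_sq (by positivity), max_self, div_div, div_le_div_iff₀ (by positivity) hz2]
    have hg := h.one_add_norm_le ha h0 hz
    have hpos : 0 ≤ (1 - ‖f z‖) * (1 - ‖z‖) := by positivity
    nlinarith [mul_le_mul_of_nonneg_left hg hpos]
  filter_upwards [hqc.eventually_lt_const hqz, self_mem_nhdsWithin] with w hwq hw
  have hfw := h.mapsTo hw
  have hw1 := one_sub_norm_sq_pos hw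
  refine (abs_quasihyperbolicDist_unitBall_sub_le (h.mapsTo hx) hfw hfz).trans ?_
  have hnorm : ‖f w - f z‖ = ‖w - z‖ *
      √((1 - ‖f w‖ ^ 2) * (1 - ‖f z‖ ^ 2) / ((1 - ‖w‖ ^ 2) * (1 - ‖z‖ ^ 2))) := by
    rw [← Real.sqrt_sq (norm_nonneg (f w - f z)), ← Real.sqrt_sq (norm_nonneg (w - z)),
      ← Real.sqrt_mul (sq_nonneg _), ← mul_div_assoc]
    congr 1
    rw [eq_div_iff (by positivity), h.norm_sub_sq w hw z hz]
  rw [hnorm, mul_div_assoc, mul_comm]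
  exact mul_le_mul_of_nonneg_right hwq.le (norm_nonneg _)

theorem one_add_norm_le_of_quasihyperbolicDist_map_le (h : IsHyperbolicIsometry f g) {c : ℝ}
    (hc : ∀ x ∈ ball (0 : E) 1, ∀ y ∈ ball (0 : E) 1,
      quasihyperbolicDist (ball (0 : E) 1) (f x) (f y) ≤
        c * quasihyperbolicDist (ball (0 : E) 1) x y) : 1 + ‖f 0‖ ≤ c := by
  have hB0 : (0 : E) ∈ ball (0 : E) 1 := mem_ball_self one_pos
  set p := f 0 with hp
  have hpB : p ∈ ball (0 : E) 1 := h.mapsTo hB0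
  have hgp : g p = 0 := h.leftInv 0 hB0
  have ha1 : ‖p‖ < 1 := mem_ball_zero_iff.1 hpB
  obtain ⟨e, he, hpe⟩ := exists_norm_eq_one_smul_eq p
  set a := ‖p‖ with ha
  have ha0 : 0 ≤ a := norm_nonneg p
  -- The test points are chosen in the image, moving radially outward from `p = f 0`, because the
  -- lower bound for `k` is exact to first order only in that direction. They are pulled back by `g`
  -- to points near `0`; here `a` denotes `|f 0|`.
  set q : ℝ → E := fun t => (a + t) • e with hq
  have hq0 : q 0 = p := by rw [hq]; simp [← hpe]
  have hqn : ∀ t, 0 < t → ‖q t‖ = a + t := fun t ht => by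
    rw [hq, norm_smul, he, mul_one, Real.norm_of_nonneg (by positivity)]
  have hqB : ∀ t, 0 < t → t < 1 - a → q t ∈ ball (0 : E) 1 := fun t h0 h1 => by
    rw [mem_ball_zero_iff, hqn t h0]
    linarith
  have key : ∀ t, 0 < t → t < 1 - a → 0 ≤ c ∧
      (1 - a ^ 2) * (1 - (a + t) ^ 2) * (1 - ‖g (q t)‖) ≤
        c ^ 2 * (1 - a) ^ 2 * (1 + ‖g (q t)‖) := by
    intro t ht0 ht1
    have hqt := hqB t ht0 ht1
    have hgq := h.mapsTo_inv hqt
    have hv1 : ‖g (q t)‖ < 1 := mem_ball_zero_iff.1 hgq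
    have H := h.norm_sub_sq _ hgq 0 hB0
    have hlow := div_le_quasihyperbolicDist_unitBall hpB hqt (by rw [hqn t ht0]; linarith)
    have hmid := hc 0 hB0 _ hgq
    have hup := quasihyperbolicDist_unitBall_le hB0 hgq
    have hk := quasihyperbolicDist_nonneg (ball (0 : E) 1) 0 (g (q t))
    have hd : ‖q t - p‖ = t := by
      have : q t - p = t • e := by rw [hpe, hq, ← sub_smul, add_sub_cancel_left]
      rw [this, norm_smul, he, mul_one, Real.norm_of_nonneg ht0.le]
    rw [h.rightInv _ hqt, ← hp, hd, sub_zero, norm_zero, hqn t ht0] at H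
    rw [hqn t ht0, add_sub_cancel_left] at hlow
    rw [h.rightInv _ hqt, ← hp] at hmid
    rw [sub_zero, norm_zero, max_eq_right (norm_nonneg _)] at hup
    have hv0 := norm_nonneg (g (q t))
    rw [← ha] at H hlow
    generalize ‖g (q t)‖ = v at *
    have hlow' : 0 < t / (1 - a) := div_pos ht0 (by linarith)
    have hc0 : 0 ≤ c := by
      by_contra! hneg
      nlinarith
    refine ⟨hc0, ?_⟩
    have h1 : t / (1 - a) ≤ c * (v / (1 - v)) :=
      (hlow.trans hmid).trans (mul_le_mul_of_nonneg_left hup hc0)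
    have h2 : t * (1 - v) ≤ c * v * (1 - a) := by
      rwa [← mul_div_assoc, div_le_div_iff₀ (by linarith) (by linarith)] at h1
    have h3 : (t * (1 - v)) ^ 2 ≤ (c * v * (1 - a)) ^ 2 :=
      pow_le_pow_left₀ (mul_nonneg ht0.le (by linarith)) h2 2
    have hvpos : 0 < v := by
      refine hv0.lt_of_ne' ?_
      rintro rfl
      nlinarith
    have hpos : 0 < v ^ 2 * (1 - v) := mul_pos (by positivity) (by linarith)
    refine le_of_mul_le_mul_left ?_ hpos
    -- The identity `H`, `t² (1 - v²) = v² (1 - (a + t)²)(1 - a²)`, eliminates `t²` from the squared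
    -- estimate `h3`.
    nlinarith [mul_le_mul_of_nonneg_right h3 (show 0 ≤ 1 + v by linarith)]
  have hev : ∀ᶠ t in 𝓝[>] (0 : ℝ), 0 < t ∧ t < 1 - a := Ioo_mem_nhdsGT (by linarith)
  have hc0 : 0 ≤ c := by
    obtain ⟨t, ht⟩ := hev.exists
    exact (key t ht.1 ht.2).1
  have hqt : Tendsto q (𝓝[>] 0) (𝓝[ball (0 : E) 1] p) := by
    refine tendsto_nhdsWithin_iff.2 ⟨?_, hev.mono fun t ht => hqB t ht.1 ht.2⟩
    have : Continuous q := by fun_prop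
    exact hq0 ▸ (this.tendsto 0).mono_left nhdsWithin_le_nhds
  have hvt : Tendsto (fun t => ‖g (q t)‖) (𝓝[>] 0) (𝓝 0) := by
    have := ((h.symm.continuousOn p hpB).tendsto.comp hqt).norm
    simpa [hgp] using this
  have hid : Tendsto (fun t : ℝ => t) (𝓝[>] 0) (𝓝 0) := nhdsWithin_le_nhds
  -- As `t → 0` this becomes `(1 - a²)² ≤ c² (1 - a)²`.
  have hlim : (1 - a ^ 2) * (1 - (a + 0) ^ 2) * (1 - 0) ≤ c ^ 2 * (1 - a) ^ 2 * (1 + 0) :=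
    le_of_tendsto_of_tendsto
      ((tendsto_const_nhds.mul (tendsto_const_nhds.sub ((tendsto_const_nhds.add hid).pow 2))).mul
        (tendsto_const_nhds.sub hvt))
      (tendsto_const_nhds.mul (tendsto_const_nhds.add hvt))
      (hev.mono fun t ht => (key t ht.1 ht.2).2)
  have h1 : (1 + a) ^ 2 ≤ c ^ 2 := by
    have hpos : 0 < (1 - a) ^ 2 := pow_pos (by linarith) 2
    refine le_of_mul_le_mul_right ?_ hpos
    nlinarith
  exact (pow_le_pow_iff_left₀ (by positivity) hc0 two_ne_zero).1 h1

end IsHyperbolicIsometry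

end UnitBall

/-! ### Möbius self-maps as hyperbolic isometries, and the main theorem -/

theorem IsMobiusSelfMap.exists_isHyperbolicIsometry {E : Type*} [NormedAddCommGroup E]
    [InnerProductSpace ℝ E] [Nontrivial E] {h : E → E}
    (hmob : IsMobiusSelfMap (ball (0 : E) 1) h) {a : E} (ha : a ∈ ball (0 : E) 1) (h0 : h a = 0) :
    ∃ g, IsHyperbolicIsometry h g := by
  have hmaps : MapsTo h (ball (0 : E) 1) (ball (0 : E) 1) := mapsTo_iff_image_subset.2 hmob.1.subset
  have hsurj : SurjOn h (ball (0 : E) 1) (ball (0 : E) 1) := hmob.1.superset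
  have hinj : InjOn h (ball (0 : E) 1) := by
    intro x hx y hy hxy
    have H := hmob.norm_sub_sq ha h0 hx hy
    have h1 := one_sub_norm_sq_pos (hmaps hx)
    have h2 := one_sub_norm_sq_pos (hmaps hy)
    rw [sub_eq_zero.2 hxy, norm_zero, zero_pow two_ne_zero, zero_mul, eq_comm,
      mul_eq_zero_iff_right (by positivity), sq_eq_zero_iff, norm_eq_zero, sub_eq_zero] at H
    exact H
  exact ⟨Function.invFunOn h (ball (0 : E) 1), hmaps, hsurj.mapsTo_invFunOn,
    fun x hx => hinj.leftInvOn_invFunOn hx, fun x hx => hsurj.rightInvOn_invFunOn hx,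
    fun x hx y hy => hmob.norm_sub_sq ha h0 hx hy⟩

theorem theorem1p3 (n : ℕ) (hn : 1 ≤ n)
    (a : EuclideanSpace ℝ (Fin n)) (ha : a ∈ ball (0 : EuclideanSpace ℝ (Fin n)) 1)
    (h : EuclideanSpace ℝ (Fin n) → EuclideanSpace ℝ (Fin n))
    (hmob : IsMobiusSelfMap (ball (0 : EuclideanSpace ℝ (Fin n)) 1) h)
    (h0 : h a = 0) :
    (∀ x ∈ ball (0 : EuclideanSpace ℝ (Fin n)) 1, ∀ y ∈ ball (0 : EuclideanSpace ℝ (Fin n)) 1,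
      1 / (1 + ‖a‖) * quasihyperbolicDist (ball 0 1) x y
          ≤ quasihyperbolicDist (ball 0 1) (h x) (h y) ∧
      quasihyperbolicDist (ball 0 1) (h x) (h y)
          ≤ (1 + ‖a‖) * quasihyperbolicDist (ball 0 1) x y) ∧
    (∀ c : ℝ,
      (∀ x ∈ ball (0 : EuclideanSpace ℝ (Fin n)) 1, ∀ y ∈ ball (0 : EuclideanSpace ℝ (Fin n)) 1,
        quasihyperbolicDist (ball 0 1) (h x) (h y) ≤ c * quasihyperbolicDist (ball 0 1) x y) →
      1 + ‖a‖ ≤ c) ∧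
    (∀ c : ℝ,
      (∀ x ∈ ball (0 : EuclideanSpace ℝ (Fin n)) 1, ∀ y ∈ ball (0 : EuclideanSpace ℝ (Fin n)) 1,
        c * quasihyperbolicDist (ball 0 1) x y ≤ quasihyperbolicDist (ball 0 1) (h x) (h y)) →
      c ≤ 1 / (1 + ‖a‖)) := by
  have : Nonempty (Fin n) := ⟨⟨0, hn⟩⟩
  obtain ⟨g, H⟩ := hmob.exists_isHyperbolicIsometry ha h0
  have hB0 : (0 : EuclideanSpace ℝ (Fin n)) ∈ ball (0 : EuclideanSpace ℝ (Fin n)) 1 :=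
    mem_ball_self one_pos
  have hn0 := H.norm_map_zero ha h0
  have hg0 : g 0 = a := by rw [← h0, H.leftInv a ha]
  refine ⟨fun x hx y hy => ⟨?_, H.quasihyperbolicDist_map_le ha h0 hx hy⟩, fun c hc => ?_,
    fun c hc => ?_⟩
  -- The upper bound for the inverse `g`, whose zero is `h 0`, a point of norm `|a|`.
  · have := H.symm.quasihyperbolicDist_map_le (H.mapsTo hB0) (H.leftInv 0 hB0) (H.mapsTo hx)
      (H.mapsTo hy)
    rw [H.leftInv x hx, H.leftInv y hy, hn0] at this
    rw [one_div, inv_mul_le_iff₀ (by positivity)]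
    exact this
  · rw [← hn0]
    exact H.one_add_norm_le_of_quasihyperbolicDist_map_le hc
  · rcases le_or_gt c 0 with hc0 | hc0
    · exact hc0.trans (by positivity)
    -- For `c > 0` the assumption says that `g` satisfies the upper bound with constant `1 / c`, and
    -- `|g 0| = |a|`.
    rw [le_one_div hc0 (by positivity), ← hg0]
    refine H.symm.one_add_norm_le_of_quasihyperbolicDist_map_le fun x hx y hy => ?_
    have := hc _ (H.mapsTo_inv hx) _ (H.mapsTo_inv hy)
    rw [H.rightInv x hx, H.rightInv y hy] at this
    rwa [one_div, ← div_eq_inv_mul, le_div_iff₀' hc0]
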